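/- Let $\boldsymbol\mu\in\mathbb{R}^n$ and $\boldsymbol\nu\in\mathbb{R}^m$ be probability vectors, let $\mathbf{T}\in\Pi(\boldsymbol\mu,\boldsymbol\nu)=\{\mathbf{T}\in\mathbb{R}^{n\times m}:\mathbf{T}_{i,j}\ge 0,\ \mathbf{T}\mathbf{1}_m=\boldsymbol\mu,\ \mathbf{T}^\top\mathbf{1}_n=\boldsymbol\nu\}$ be a transport plan (for instance the solution of an entropy-regularized optimal transport problem with these marginals), and let $f:\mathbb{R}^{n\times m}\to\mathbb{R}$ be differentiable at $\mathbf{T}$ with gradient $\nabla_{\mathbf{T}}f$. Consider the adjoint linear system $\mathbf{A}\mathbf{y}=\mathbf{b}$ in $\mathbb{R}^{n+m}$ with $$\mathbf{A}=\begin{bmatrix}\operatorname{diag}(\boldsymbol\mu)&\mathbf{T}\\ \mathbf{T}^\top&\operatorname{diag}(\boldsymbol\nu)\end{bmatrix},\qquad \mathbf{b}=\begin{bmatrix}(\mathbf{T}\odot\nabla_{\mathbf{T}}f)\mathbf{1}_m\\ (\mathbf{T}\odot\nabla_{\mathbf{T}}f)^\top\mathbf{1}_n\end{bmatrix},$$ where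 $\odot$ is the entrywise product. Then $\mathbf{A}$ has nonzero eigenvalues, and all of them are positive. Let $\lambda_1$ and $\lambda_r$ be the largest and the smallest nonzero eigenvalue of $\mathbf{A}$, and put $$\rho=\frac{\sqrt{\lambda_1/\lambda_r}-1}{\sqrt{\lambda_1/\lambda_r}+1}\in[0,1).$$ For every starting vector $\mathbf{y}^{(0)}\in\mathbb{R}^{n+m}$, the conjugate gradient method for $\mathbf{A}\mathbf{y}=\mathbf{b}$ (in exact arithmetic, stopped, i.e. continued constantly, once the residual is $0$) is well defined: as long as the residual is nonzero, the search direction $\mathbf{p}$ satisfies $\mathbf{p}^\top\mathbf{A}\mathbf{p}>0$. Its iterates $\mathbf{y}^{(k)}$ converge to a solution of the system linearly with rate $\rho$. More precisely, with $\|\mathbf{v}\|_{\mathbf{A}}=\sqrt{\mathbf{v}^\top\mathbf{A}\mathbf{v}}$, every solution $\mathbf{y}$ of $\mathbf{A}\mathbf{y}=\mathbf{b}$ satisfies $$\|\mathbf{y}^{(k)}-\mathbf{y}\|_{\mathbf{A}}\le 2\rho^k\,\|\mathbf{y}^{(0)}-\mathbf{y}\|_{\mathbf{A}}\qquad(k\ge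 0),$$ and there is a solution $\mathbf{y}^*$ with $\mathbf{y}^{(k)}\to\mathbf{y}^*$ and $$\|\mathbf{y}^{(k)}-\mathbf{y}^*\|_2\le 2\sqrt{\lambda_1/\lambda_r}\;\rho^k\,\|\mathbf{y}^{(0)}-\mathbf{y}^*\|_2\qquad(k\ge 0).$$ -/

import Mathlib

open scoped Matrix

/-- `T` is a transport plan between `μ` and `ν`, i.e. `T ∈ Π(μ, ν)`:
nonnegative entries, row sums `T 1 = μ` and column sums `Tᵀ 1 = ν`. -/
structure IsTransportPlan {n m : ℕ} (μ : Fin n → ℝ) (ν : Fin m → ℝ)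
    (T : Matrix (Fin n) (Fin m) ℝ) : Prop where
  nonneg : ∀ i j, 0 ≤ T i j
  row_sum : T *ᵥ 1 = μ
  col_sum : Tᵀ *ᵥ 1 = ν

/-- `G = ∇f(T)`: the function `f` of an `n × m` matrix is (Fréchet) differentiable at `T`, with
gradient `G` for the entrywise (Frobenius) inner product. Matrices are viewed as elements of the
Euclidean space `ℝ^(n × m)`. -/
def HasMatrixGradientAt {n m : ℕ} (f : Matrix (Fin n) (Fin m) ℝ → ℝ)
    (G T : Matrix (Fin n) (Fin m) ℝ) : Prop :=
  HasGradientAt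
    (fun x : EuclideanSpace ℝ (Fin n × Fin m) => f (Matrix.of fun i j => x (i, j)))
    (WithLp.toLp 2 fun q : Fin n × Fin m => G q.1 q.2)
    (WithLp.toLp 2 fun q : Fin n × Fin m => T q.1 q.2)

/-- The coefficient matrix `A = [diag μ, T; Tᵀ, diag ν]` of the adjoint system. -/
def adjointMatrix {n m : ℕ} (μ : Fin n → ℝ) (ν : Fin m → ℝ) (T : Matrix (Fin n) (Fin m) ℝ) :
    Matrix (Fin n ⊕ Fin m) (Fin n ⊕ Fin m) ℝ :=
  Matrix.fromBlocks (Matrix.diagonal μ) T Tᵀ (Matrix.diagonal ν)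

/-- The right-hand side `b = [(T ⊙ G) 1; (T ⊙ G)ᵀ 1]` of the adjoint system, with `G = ∇f(T)`. -/
def adjointRhs {n m : ℕ} (T G : Matrix (Fin n) (Fin m) ℝ) : Fin n ⊕ Fin m → ℝ :=
  Sum.elim ((T ⊙ G) *ᵥ 1) ((T ⊙ G)ᵀ *ᵥ 1)

/-- The state of the conjugate gradient method: iterate, residual, search direction. -/
structure CGState (ι : Type*) where
  /-- the current iterate -/
  iter : ι → ℝ
  /-- the current residual -/
  res : ι → ℝ
  /-- the current search direction -/
  dir : ι → ℝ

open Classical in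
/-- One step of the conjugate gradient method for the coefficient matrix `A`:
`a = (r·r)/(p·Ap)`, `x' = x + a p`, `r' = r - a Ap`, `c = (r'·r')/(r·r)`, `p' = r' + c p`.
When the residual is `0` the method has terminated and the state no longer changes. -/
noncomputable def cgStep {ι : Type*} [Fintype ι] (A : Matrix ι ι ℝ) (s : CGState ι) :
    CGState ι :=
  if s.res = 0 then s
  else
    let a : ℝ := (s.res ⬝ᵥ s.res) / (s.dir ⬝ᵥ (A *ᵥ s.dir))
    let r' : ι → ℝ := s.res - a • (A *ᵥ s.dir)
    let c : ℝ := (r' ⬝ᵥ r') / (s.res ⬝ᵥ s.res)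
    { iter := s.iter + a • s.dir
      res := r'
      dir := r' + c • s.dir }

/-- The state after `k` steps of the conjugate gradient method for `A y = b` started at `y₀`
(initial residual and initial direction `b - A y₀`). -/
noncomputable def cgState {ι : Type*} [Fintype ι] (A : Matrix ι ι ℝ) (b y₀ : ι → ℝ) :
    ℕ → CGState ι
  | 0 => { iter := y₀, res := b - A *ᵥ y₀, dir := b - A *ᵥ y₀ }
  | k + 1 => cgStep A (cgState A b y₀ k)

/-- The `k`-th conjugate gradient iterate `y⁽ᵏ⁾` for `A y = b` started at `y₀`. -/
noncomputable def cgIter {ι : Type*} [Fintype ι] (A : Matrix ι ι ℝ) (b y₀ : ι → ℝ) (k : ℕ) :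
    ι → ℝ :=
  (cgState A b y₀ k).iter

/-- The energy (semi)norm `‖v‖_A = √(vᵀ A v)`. In an orthonormal eigenbasis of a positive
semidefinite `A` it is `√(wᵀ Λ w)`, where `Λ` is the diagonal matrix of the nonzero eigenvalues and
`w` the corresponding coordinates of `v`. -/
noncomputable def energyNorm {ι : Type*} [Fintype ι] (A : Matrix ι ι ℝ) (v : ι → ℝ) : ℝ :=
  √(v ⬝ᵥ (A *ᵥ v))

/-- The Euclidean norm `‖v‖₂ = √(vᵀ v)`. -/
noncomputable def euclNorm {ι : Type*} [Fintype ι] (v : ι → ℝ) : ℝ :=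
  √(v ⬝ᵥ v)

/-- The set of nonzero (real) eigenvalues of a real square matrix. -/
def nonzeroEigenvalues {ι : Type*} [Fintype ι] [DecidableEq ι] (A : Matrix ι ι ℝ) : Set ℝ :=
  {lam : ℝ | lam ≠ 0 ∧ Module.End.HasEigenvalue (Matrix.toLin' A) lam}

/-- The convergence factor `(√(λ₁/λᵣ) - 1) / (√(λ₁/λᵣ) + 1)`. -/
noncomputable def cgRate (lam₁ lamᵣ : ℝ) : ℝ :=
  (√(lam₁ / lamᵣ) - 1) / (√(lam₁ / lamᵣ) + 1)

/-!
The conjugate gradient iterate minimizes `‖y⁽ᵏ⁾ - y‖_A` over `y₀` plus the Krylov space of the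
initial residual. Comparing it with `q(A) (y₀ - y)` for a polynomial `q` of degree at most `k` with
`q(0) = 1` bounds the relative error by the maximum of `|q|` on the nonzero spectrum of `A`, and the
Chebyshev polynomial transplanted to `[lamᵣ, lam₁]` and normalized at `0` makes this maximum at most
`2 ρᵏ`. A zero eigenvalue does no harm, for two reasons: the energy seminorm ignores the kernel, and
for a consistent system all search directions lie in the range of `A`, on which `A` is positive
definite. Hence the iterates approach the solution that differs from `y₀` by an element of the
range.

The adjoint system is consistent because `A v = adjointRhs T (vᵢ + vⱼ)ᵢⱼ`, so that
`vᵀ A v = ∑ Tᵢⱼ (vᵢ + vⱼ)²` is nonnegative and a kernel vector `v` satisfies `Tᵢⱼ (vᵢ + vⱼ) = 0`,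
which makes it orthogonal to every `adjointRhs T G`.
-/

open Matrix Polynomial Filter Topology

/-! ### Range and kernel of a symmetric matrix -/

section Symmetric

variable {ι R : Type*} [Fintype ι]

theorem mulVec_dotProduct_comm [CommSemiring R] {A : Matrix ι ι R} (hA : A.IsSymm)
    (v w : ι → R) : (A *ᵥ v) ⬝ᵥ w = v ⬝ᵥ (A *ᵥ w) := by
  rw [dotProduct_mulVec, ← mulVec_transpose, hA.eq]

theorem disjoint_range_ker_mulVecLin [CommRing R] [LinearOrder R] [IsStrictOrderedRing R]
    {A : Matrix ι ι R} (hA : A.IsSymm) :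
    Disjoint (LinearMap.range A.mulVecLin) (LinearMap.ker A.mulVecLin) := by
  rw [Submodule.disjoint_def]
  rintro _ ⟨w, rfl⟩ hker
  rw [LinearMap.mem_ker, mulVecLin_apply] at hker
  rw [← dotProduct_self_eq_zero, mulVecLin_apply, mulVec_dotProduct_comm hA, ← mulVecLin_apply A w,
    hker, dotProduct_zero]

variable {K : Type*} [Field K] [LinearOrder K] [IsStrictOrderedRing K] {A : Matrix ι ι K}

theorem range_sup_ker_mulVecLin (hA : A.IsSymm) :
    LinearMap.range A.mulVecLin ⊔ LinearMap.ker A.mulVecLin = ⊤ :=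
  Submodule.eq_top_of_disjoint _ _ A.mulVecLin.finrank_range_add_finrank_ker.ge
    (disjoint_range_ker_mulVecLin hA)

theorem exists_mulVec_add_eq (hA : A.IsSymm) (v : ι → K) :
    ∃ w z, A *ᵥ z = 0 ∧ A *ᵥ w + z = v := by
  have hv : v ∈ LinearMap.range A.mulVecLin ⊔ LinearMap.ker A.mulVecLin :=
    range_sup_ker_mulVecLin hA ▸ Submodule.mem_top
  obtain ⟨_, ⟨w, rfl⟩, z, hz, hwz⟩ := Submodule.mem_sup.1 hv
  exact ⟨w, z, hz, hwz⟩

theorem mem_range_mulVecLin_of_forall_dotProduct_eq_zero (hA : A.IsSymm) {b : ι → K}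
    (hb : ∀ v, A *ᵥ v = 0 → v ⬝ᵥ b = 0) : b ∈ LinearMap.range A.mulVecLin := by
  obtain ⟨w, z, hz, rfl⟩ := exists_mulVec_add_eq hA b
  have hzz : z ⬝ᵥ z = 0 := by
    simpa [dotProduct_add, ← mulVec_dotProduct_comm hA, hz] using hb z hz
  exact ⟨w, by simp [dotProduct_self_eq_zero.1 hzz]⟩

theorem exists_mulVec_eq_sub_mem_range (hA : A.IsSymm) {b : ι → K}
    (hb : b ∈ LinearMap.range A.mulVecLin) (y₀ : ι → K) :
    ∃ y, A *ᵥ y = b ∧ y₀ - y ∈ LinearMap.range A.mulVecLin := by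
  obtain ⟨x, rfl⟩ := hb
  obtain ⟨w, z, hz, hwz⟩ := exists_mulVec_add_eq hA (y₀ - x)
  refine ⟨x + z, by rw [mulVec_add, hz, add_zero, mulVecLin_apply], w, ?_⟩
  rw [mulVecLin_apply, eq_sub_of_add_eq hwz, sub_sub]

theorem dotProduct_mulVec_pos_of_mem_range {A : Matrix ι ι ℝ} (hA : A.PosSemidef) {v : ι → ℝ}
    (hv : v ∈ LinearMap.range A.mulVecLin) (hv0 : v ≠ 0) : 0 < v ⬝ᵥ (A *ᵥ v) := by
  refine (hA.dotProduct_mulVec_nonneg v).lt_of_ne' fun hvAv => hv0 ?_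
  have hAv : v ∈ LinearMap.ker A.mulVecLin := (hA.dotProduct_mulVec_zero_iff v).1 hvAv
  exact Submodule.disjoint_def.1
    (disjoint_range_ker_mulVecLin (isHermitian_iff_isSymm.1 hA.isHermitian)) v hv hAv

end Symmetric

/-! ### Eigencoordinates -/

section Spectral

variable {ι : Type*} [Fintype ι] [DecidableEq ι] {A : Matrix ι ι ℝ}

/-- The `i`-th coordinate of `v` in Mathlib's orthonormal eigenbasis of the symmetric matrix `A`,
as a dot product, so that no passage between `ι → ℝ` and `EuclideanSpace ℝ ι` is left to its
users. -/
noncomputable def eigenCoord (hA : A.IsHermitian) (v : ι → ℝ) (i : ι) : ℝ :=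
  hA.eigenvectorBasis i ⬝ᵥ v

theorem dotProduct_eq_sum_eigenCoord (hA : A.IsHermitian) (v w : ι → ℝ) :
    v ⬝ᵥ w = ∑ i, eigenCoord hA v i * eigenCoord hA w i := by
  have parseval := hA.eigenvectorBasis.sum_inner_mul_inner (WithLp.toLp 2 w) (WithLp.toLp 2 v)
  simp only [EuclideanSpace.inner_eq_star_dotProduct, star_trivial] at parseval
  rw [← parseval]
  exact Finset.sum_congr rfl fun i _ => by
    rw [mul_comm, eigenCoord, eigenCoord, dotProduct_comm _ v]

theorem eigenCoord_mulVec (hA : A.IsHermitian) (v : ι → ℝ) (i : ι) :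
    eigenCoord hA (A *ᵥ v) i = hA.eigenvalues i * eigenCoord hA v i := by
  rw [eigenCoord, ← mulVec_dotProduct_comm (isHermitian_iff_isSymm.1 hA),
    hA.mulVec_eigenvectorBasis, smul_dotProduct, smul_eq_mul, eigenCoord]

theorem eigenCoord_pow_mulVec (hA : A.IsHermitian) (k : ℕ) (v : ι → ℝ) (i : ι) :
    eigenCoord hA ((A ^ k) *ᵥ v) i = hA.eigenvalues i ^ k * eigenCoord hA v i := by
  induction k with
  | zero => rw [pow_zero, pow_zero, one_mulVec, one_mul]
  | succ k ih => rw [pow_succ', ← mulVec_mulVec, eigenCoord_mulVec, ih, pow_succ', mul_assoc]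

theorem eigenCoord_aeval_mulVec (hA : A.IsHermitian) (q : ℝ[X]) (v : ι → ℝ) (i : ι) :
    eigenCoord hA (aeval A q *ᵥ v) i = q.eval (hA.eigenvalues i) * eigenCoord hA v i := by
  induction q using Polynomial.induction_on' with
  | add p q hp hq =>
    rw [map_add, add_mulVec, eigenCoord, dotProduct_add, ← eigenCoord, ← eigenCoord, hp, hq,
      eval_add, add_mul]
  | monomial k a =>
    rw [aeval_monomial, ← Algebra.smul_def, smul_mulVec, eigenCoord, dotProduct_smul,
      ← eigenCoord, eigenCoord_pow_mulVec, eval_monomial, smul_eq_mul, mul_assoc]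

theorem dotProduct_self_eq_sum_eigenCoord (hA : A.IsHermitian) (v : ι → ℝ) :
    v ⬝ᵥ v = ∑ i, eigenCoord hA v i ^ 2 := by
  simp only [dotProduct_eq_sum_eigenCoord hA, sq]

theorem dotProduct_mulVec_eq_sum_eigenCoord (hA : A.IsHermitian) (v : ι → ℝ) :
    v ⬝ᵥ (A *ᵥ v) = ∑ i, hA.eigenvalues i * eigenCoord hA v i ^ 2 := by
  rw [dotProduct_eq_sum_eigenCoord hA]
  exact Finset.sum_congr rfl fun i _ => by rw [eigenCoord_mulVec]; ring

theorem nonzeroEigenvalues_eq_range_diff (hA : A.IsHermitian) :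
    nonzeroEigenvalues A = Set.range hA.eigenvalues \ {0} := by
  ext x
  rw [nonzeroEigenvalues, Set.mem_ofPred_eq, Module.End.hasEigenvalue_iff_mem_spectrum,
    spectrum_toLin', hA.spectrum_real_eq_range_eigenvalues, and_comm, Set.mem_sdiff_singleton]

theorem eigenvalues_mem_nonzeroEigenvalues (hA : A.IsHermitian) {i : ι}
    (hi : hA.eigenvalues i ≠ 0) : hA.eigenvalues i ∈ nonzeroEigenvalues A := by
  rw [nonzeroEigenvalues_eq_range_diff hA]
  exact ⟨⟨i, rfl⟩, hi⟩

theorem finite_nonzeroEigenvalues (hA : A.IsHermitian) : (nonzeroEigenvalues A).Finite := by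
  rw [nonzeroEigenvalues_eq_range_diff hA]
  exact (Set.finite_range _).sdiff

theorem nonempty_nonzeroEigenvalues (hA : A.IsHermitian) (hA0 : A ≠ 0) :
    (nonzeroEigenvalues A).Nonempty := by
  obtain ⟨i, hi⟩ := Function.ne_iff.1 (hA.eigenvalues_eq_zero_iff.not.2 hA0)
  exact ⟨_, eigenvalues_mem_nonzeroEigenvalues hA hi⟩

theorem pos_of_mem_nonzeroEigenvalues (hA : A.PosSemidef) {x : ℝ}
    (hx : x ∈ nonzeroEigenvalues A) : 0 < x := by
  rw [nonzeroEigenvalues_eq_range_diff hA.isHermitian] at hx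
  obtain ⟨⟨i, rfl⟩, hi⟩ := hx
  exact (hA.eigenvalues_nonneg i).lt_of_ne' hi

theorem energyNorm_aeval_mulVec_le (hA : A.PosSemidef) {q : ℝ[X]} {C : ℝ} (hC : 0 ≤ C)
    (hq : ∀ x ∈ nonzeroEigenvalues A, |q.eval x| ≤ C) (v : ι → ℝ) :
    energyNorm A (aeval A q *ᵥ v) ≤ C * energyNorm A v := by
  have hH := hA.isHermitian
  rw [energyNorm, energyNorm, ← Real.sqrt_sq hC, ← Real.sqrt_mul (sq_nonneg C)]
  refine Real.sqrt_le_sqrt ?_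
  rw [dotProduct_mulVec_eq_sum_eigenCoord hH, dotProduct_mulVec_eq_sum_eigenCoord hH,
    Finset.mul_sum]
  refine Finset.sum_le_sum fun i _ => ?_
  rcases eq_or_ne (hH.eigenvalues i) 0 with hi | hi
  · simp [hi]
  · have hqi : q.eval (hH.eigenvalues i) ^ 2 ≤ C ^ 2 := by
      rw [← sq_abs]
      gcongr
      exact hq _ (eigenvalues_mem_nonzeroEigenvalues hH hi)
    have hnonneg : 0 ≤ hH.eigenvalues i * eigenCoord hH v i ^ 2 :=
      mul_nonneg (hA.eigenvalues_nonneg i) (sq_nonneg _)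
    calc hH.eigenvalues i * eigenCoord hH (aeval A q *ᵥ v) i ^ 2
        = q.eval (hH.eigenvalues i) ^ 2 * (hH.eigenvalues i * eigenCoord hH v i ^ 2) := by
          rw [eigenCoord_aeval_mulVec]; ring
      _ ≤ C ^ 2 * (hH.eigenvalues i * eigenCoord hH v i ^ 2) := by gcongr

theorem energyNorm_le_sqrt_mul_euclNorm (hA : A.IsHermitian) {a : ℝ} (ha : 0 ≤ a)
    (h : ∀ x ∈ nonzeroEigenvalues A, x ≤ a) (v : ι → ℝ) :
    energyNorm A v ≤ √a * euclNorm v := by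
  rw [energyNorm, euclNorm, ← Real.sqrt_mul ha]
  refine Real.sqrt_le_sqrt ?_
  rw [dotProduct_mulVec_eq_sum_eigenCoord hA, dotProduct_self_eq_sum_eigenCoord hA,
    Finset.mul_sum]
  refine Finset.sum_le_sum fun i _ => mul_le_mul_of_nonneg_right ?_ (sq_nonneg _)
  rcases eq_or_ne (hA.eigenvalues i) 0 with hi | hi
  · rwa [hi]
  · exact h _ (eigenvalues_mem_nonzeroEigenvalues hA hi)

theorem sqrt_mul_euclNorm_le_energyNorm (hA : A.IsHermitian) {c : ℝ} (hc : 0 ≤ c)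
    (h : ∀ x ∈ nonzeroEigenvalues A, c ≤ x) {v : ι → ℝ}
    (hv : v ∈ LinearMap.range A.mulVecLin) : √c * euclNorm v ≤ energyNorm A v := by
  rw [energyNorm, euclNorm, ← Real.sqrt_mul hc]
  refine Real.sqrt_le_sqrt ?_
  rw [dotProduct_mulVec_eq_sum_eigenCoord hA, dotProduct_self_eq_sum_eigenCoord hA,
    Finset.mul_sum]
  refine Finset.sum_le_sum fun i _ => ?_
  rcases eq_or_ne (hA.eigenvalues i) 0 with hi | hi
  · obtain ⟨w, rfl⟩ := hv
    simp [eigenCoord_mulVec, hi]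
  · gcongr
    exact h _ (eigenvalues_mem_nonzeroEigenvalues hA hi)

end Spectral

theorem norm_le_euclNorm {ι : Type*} [Fintype ι] (v : ι → ℝ) : ‖v‖ ≤ euclNorm v := by
  refine (pi_norm_le_iff_of_nonneg (Real.sqrt_nonneg _)).2 fun i => Real.abs_le_sqrt ?_
  rw [sq]
  exact Finset.single_le_sum (f := fun j => v j * v j) (fun j _ => mul_self_nonneg (v j))
    (Finset.mem_univ i)

theorem tendsto_of_euclNorm_sub_le_geometric {ι : Type*} [Fintype ι] {x : ℕ → ι → ℝ}
    {y : ι → ℝ} {C ρ : ℝ} (hρ0 : 0 ≤ ρ) (hρ1 : ρ < 1) (h : ∀ k, euclNorm (x k - y) ≤ C * ρ ^ k) :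
    Tendsto x atTop (𝓝 y) := by
  rw [tendsto_iff_norm_sub_tendsto_zero]
  refine squeeze_zero (fun _ => norm_nonneg _) (fun k => (norm_le_euclNorm _).trans (h k)) ?_
  simpa using (tendsto_pow_atTop_nhds_zero_of_lt_one hρ0 hρ1).const_mul C

/-! ### Chebyshev polynomials -/

theorem eval_chebyshevT_add_inv {z : ℝ} (hz : 0 < z) (k : ℕ) :
    (Chebyshev.T ℝ k).eval ((z + z⁻¹) / 2) = (z ^ k + (z ^ k)⁻¹) / 2 := by
  rw [← Real.cosh_log hz, Chebyshev.T_real_cosh, Int.cast_natCast, ← Real.log_pow,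
    Real.cosh_log (pow_pos hz k)]

theorem cgRate_nonneg {a c : ℝ} (hc : 0 < c) (hca : c ≤ a) : 0 ≤ cgRate a c := by
  have hκ : 1 ≤ √(a / c) := by rwa [Real.one_le_sqrt, one_le_div hc]
  exact div_nonneg (by linarith) (by linarith)

theorem cgRate_lt_one (a c : ℝ) : cgRate a c < 1 := by
  have hκ : 0 ≤ √(a / c) := Real.sqrt_nonneg _
  rw [cgRate, div_lt_one (by linarith)]
  linarith

theorem cgRate_self {c : ℝ} (hc : c ≠ 0) : cgRate c c = 0 := by simp [cgRate, hc]

theorem cgRate_pos {a c : ℝ} (hc : 0 < c) (hca : c < a) : 0 < cgRate a c := by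
  have hκ : 1 < √(a / c) := by rwa [Real.lt_sqrt zero_le_one, one_pow, one_lt_div hc]
  exact div_pos (by linarith) (by linarith)

theorem cgRate_add_inv_div_two {a c : ℝ} (hc : 0 < c) (hca : c < a) :
    (cgRate a c + (cgRate a c)⁻¹) / 2 = (a + c) / (a - c) := by
  have hκ : 1 < √(a / c) := by rwa [Real.lt_sqrt zero_le_one, one_pow, one_lt_div hc]
  have ha : a = √(a / c) ^ 2 * c := by
    rw [Real.sq_sqrt (div_nonneg (hc.trans hca).le hc.le), div_mul_cancel₀ _ hc.ne']
  rw [cgRate]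
  generalize √(a / c) = s at hκ ha
  subst ha
  have hs_sub : s - 1 ≠ 0 := by linarith
  have hs_add : s + 1 ≠ 0 := by linarith
  have hs_sq : s ^ 2 - 1 ≠ 0 := by nlinarith
  field_simp
  ring

/-- The Chebyshev polynomial of degree `k` transplanted from `[-1, 1]` to `[c, a]` and normalized to
the value `1` at `0`; meaningful for `0 < c < a`. -/
noncomputable def normalizedChebyshev (a c : ℝ) (k : ℕ) : ℝ[X] :=
  C ((Chebyshev.T ℝ k).eval ((a + c) / (a - c)))⁻¹ *
    (Chebyshev.T ℝ k).comp (C (-2 / (a - c)) * X + C ((a + c) / (a - c)))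

theorem natDegree_normalizedChebyshev_le (a c : ℝ) (k : ℕ) :
    (normalizedChebyshev a c k).natDegree ≤ k :=
  calc (normalizedChebyshev a c k).natDegree
      ≤ ((Chebyshev.T ℝ k).comp (C (-2 / (a - c)) * X + C ((a + c) / (a - c)))).natDegree :=
        natDegree_C_mul_le _ _
    _ ≤ (Chebyshev.T ℝ k).natDegree * (C (-2 / (a - c)) * X + C ((a + c) / (a - c))).natDegree :=
        natDegree_comp_le
    _ ≤ k * 1 := by
        rw [Chebyshev.natDegree_T, Int.natAbs_natCast]
        exact Nat.mul_le_mul_left k natDegree_linear_le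
    _ = k := mul_one k

theorem inv_cgRate_pow_div_two_le_eval_chebyshevT {a c : ℝ} (hc : 0 < c) (hca : c < a) (k : ℕ) :
    (cgRate a c ^ k)⁻¹ / 2 ≤ (Chebyshev.T ℝ k).eval ((a + c) / (a - c)) := by
  have hρ := cgRate_pos hc hca
  rw [← cgRate_add_inv_div_two hc hca, eval_chebyshevT_add_inv hρ]
  linarith [pow_pos hρ k]

theorem eval_chebyshevT_pos {a c : ℝ} (hc : 0 < c) (hca : c < a) (k : ℕ) :
    0 < (Chebyshev.T ℝ k).eval ((a + c) / (a - c)) :=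
  (half_pos (inv_pos.2 (pow_pos (cgRate_pos hc hca) k))).trans_le
    (inv_cgRate_pow_div_two_le_eval_chebyshevT hc hca k)

theorem eval_zero_normalizedChebyshev {a c : ℝ} (hc : 0 < c) (hca : c < a) (k : ℕ) :
    (normalizedChebyshev a c k).eval 0 = 1 := by
  simp [normalizedChebyshev, (eval_chebyshevT_pos hc hca k).ne']

theorem abs_eval_normalizedChebyshev_le {a c t : ℝ} (hc : 0 < c) (hca : c < a)
    (ht : t ∈ Set.Icc c a) (k : ℕ) :
    |(normalizedChebyshev a c k).eval t| ≤ 2 * cgRate a c ^ k := by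
  have hac : 0 < a - c := sub_pos.2 hca
  have hρ := cgRate_pos hc hca
  have hM := eval_chebyshevT_pos hc hca k
  have hM_le := inv_cgRate_pow_div_two_le_eval_chebyshevT hc hca k
  have haffine : |-2 / (a - c) * t + (a + c) / (a - c)| ≤ 1 := by
    rw [div_mul_eq_mul_div, ← add_div, abs_div, abs_of_pos hac, div_le_one hac, abs_le]
    constructor <;> linarith [ht.1, ht.2]
  simp only [normalizedChebyshev, eval_mul, eval_C, eval_comp, eval_add, eval_X]
  generalize (Chebyshev.T ℝ k).eval ((a + c) / (a - c)) = M at hM hM_le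
  calc |M⁻¹ * (Chebyshev.T ℝ k).eval (-2 / (a - c) * t + (a + c) / (a - c))|
      ≤ M⁻¹ * 1 := by
        rw [abs_mul, abs_of_pos (inv_pos.2 hM)]
        gcongr
        exact Chebyshev.abs_eval_T_real_le_one k haffine
    _ ≤ ((cgRate a c ^ k)⁻¹ / 2)⁻¹ := by rw [mul_one]; gcongr
    _ = 2 * cgRate a c ^ k := by rw [inv_div, div_inv_eq_mul]

theorem exists_natDegree_le_eval_zero_eq_one_abs_eval_le {a c : ℝ} (hc : 0 < c) (hca : c ≤ a)
    (k : ℕ) : ∃ q : ℝ[X], q.natDegree ≤ k ∧ q.eval 0 = 1 ∧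
      ∀ t ∈ Set.Icc c a, |q.eval t| ≤ 2 * cgRate a c ^ k := by
  rcases hca.eq_or_lt with rfl | hlt
  · refine ⟨(1 - C c⁻¹ * X) ^ k, ?_, by simp, fun t ht => ?_⟩
    · refine natDegree_pow_le_of_le k ?_ |>.trans_eq (mul_one k)
      compute_degree
    · obtain rfl : t = c := le_antisymm ht.2 ht.1
      have h0 : (0 : ℝ) ≤ 0 ^ k := pow_nonneg le_rfl k
      rw [cgRate_self hc.ne']
      simpa [hc.ne', abs_of_nonneg h0] using le_mul_of_one_le_left h0 one_le_two
  · exact ⟨normalizedChebyshev a c k, natDegree_normalizedChebyshev_le a c k,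
      eval_zero_normalizedChebyshev hc hlt k,
      fun _ ht => abs_eval_normalizedChebyshev_le hc hlt ht k⟩

/-! ### The conjugate gradient method -/

section ConjugateGradient

variable {ι : Type*} [Fintype ι] (A : Matrix ι ι ℝ) (b y₀ : ι → ℝ)

/-- The residual `r⁽ᵏ⁾` of the conjugate gradient method. -/
noncomputable abbrev cgRes (k : ℕ) : ι → ℝ := (cgState A b y₀ k).res

/-- The search direction `p⁽ᵏ⁾` of the conjugate gradient method. -/
noncomputable abbrev cgDir (k : ℕ) : ι → ℝ := (cgState A b y₀ k).dir

/-- The step length `(r⁽ᵏ⁾·r⁽ᵏ⁾) / (p⁽ᵏ⁾·A p⁽ᵏ⁾)` of the conjugate gradient method. After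
termination it is `0 / 0 = 0`. -/
noncomputable def cgStepLength (k : ℕ) : ℝ :=
  (cgRes A b y₀ k ⬝ᵥ cgRes A b y₀ k) / (cgDir A b y₀ k ⬝ᵥ (A *ᵥ cgDir A b y₀ k))

/-- The weight `(r⁽ᵏ⁺¹⁾·r⁽ᵏ⁺¹⁾) / (r⁽ᵏ⁾·r⁽ᵏ⁾)` of the old search direction in the new one. After
termination it is `0 / 0 = 0`. -/
noncomputable def cgDirWeight (k : ℕ) : ℝ :=
  (cgRes A b y₀ (k + 1) ⬝ᵥ cgRes A b y₀ (k + 1)) / (cgRes A b y₀ k ⬝ᵥ cgRes A b y₀ k)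

/-- The span of the first `k` search directions. It equals the `k`-th Krylov space of the initial
residual, but only the inclusion of the latter is needed. -/
noncomputable def cgSpan (k : ℕ) : Submodule ℝ (ι → ℝ) :=
  Submodule.span ℝ (cgDir A b y₀ '' Set.Iio k)

variable {A b y₀}

theorem cgState_succ_of_cgRes_eq_zero {k : ℕ} (h : cgRes A b y₀ k = 0) :
    cgState A b y₀ (k + 1) = cgState A b y₀ k := by
  rw [cgState, cgStep, if_pos h]

theorem cgState_succ_of_cgRes_ne_zero {k : ℕ} (h : cgRes A b y₀ k ≠ 0) :
    cgState A b y₀ (k + 1) =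
      { iter := cgIter A b y₀ k + cgStepLength A b y₀ k • cgDir A b y₀ k
        res := cgRes A b y₀ k - cgStepLength A b y₀ k • (A *ᵥ cgDir A b y₀ k)
        dir := cgRes A b y₀ (k + 1) + cgDirWeight A b y₀ k • cgDir A b y₀ k } := by
  simp only [cgDirWeight, cgRes, cgState, cgStep, if_neg h]
  rfl

/- The step that annihilates the residual also annihilates the direction. Hence the recurrences
below hold for every `k`, terminated or not, and no later argument has to distinguish the two. -/
theorem cgDir_eq_zero_of_cgRes_eq_zero {k : ℕ} (h : cgRes A b y₀ k = 0) :
    cgDir A b y₀ k = 0 := by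
  induction k with
  | zero => exact h
  | succ k ih =>
    by_cases hk : cgRes A b y₀ k = 0
    · rw [cgDir, cgState_succ_of_cgRes_eq_zero hk]
      exact ih hk
    · rw [cgDir, cgState_succ_of_cgRes_ne_zero hk, cgDirWeight, h]
      simp

theorem cgIter_succ (k : ℕ) :
    cgIter A b y₀ (k + 1) = cgIter A b y₀ k + cgStepLength A b y₀ k • cgDir A b y₀ k := by
  by_cases h : cgRes A b y₀ k = 0
  · rw [cgDir_eq_zero_of_cgRes_eq_zero h, smul_zero, add_zero, cgIter,
      cgState_succ_of_cgRes_eq_zero h, cgIter]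
  · rw [cgIter, cgState_succ_of_cgRes_ne_zero h]

theorem cgRes_succ (k : ℕ) :
    cgRes A b y₀ (k + 1) =
      cgRes A b y₀ k - cgStepLength A b y₀ k • (A *ᵥ cgDir A b y₀ k) := by
  by_cases h : cgRes A b y₀ k = 0
  · rw [cgDir_eq_zero_of_cgRes_eq_zero h, mulVec_zero, smul_zero, sub_zero, cgRes,
      cgState_succ_of_cgRes_eq_zero h]
  · rw [cgRes, cgState_succ_of_cgRes_ne_zero h]

theorem cgDir_succ (k : ℕ) :
    cgDir A b y₀ (k + 1) =
      cgRes A b y₀ (k + 1) + cgDirWeight A b y₀ k • cgDir A b y₀ k := by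
  by_cases h : cgRes A b y₀ k = 0
  · have hsucc : cgRes A b y₀ (k + 1) = 0 := by rwa [cgRes, cgState_succ_of_cgRes_eq_zero h]
    rw [cgDir_eq_zero_of_cgRes_eq_zero hsucc, cgDir_eq_zero_of_cgRes_eq_zero h, hsucc, smul_zero,
      add_zero]
  · rw [cgDir, cgState_succ_of_cgRes_ne_zero h]

theorem cgRes_eq_sub_mulVec (k : ℕ) : cgRes A b y₀ k = b - A *ᵥ cgIter A b y₀ k := by
  induction k with
  | zero => rfl
  | succ k ih => rw [cgRes_succ, cgIter_succ, ih, mulVec_add, mulVec_smul, sub_sub]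

theorem cgDir_mem_range (hb : b ∈ LinearMap.range A.mulVecLin) (k : ℕ) :
    cgDir A b y₀ k ∈ LinearMap.range A.mulVecLin := by
  have hres : ∀ j, cgRes A b y₀ j ∈ LinearMap.range A.mulVecLin := fun j => by
    rw [cgRes_eq_sub_mulVec]
    exact sub_mem hb ⟨_, rfl⟩
  induction k with
  | zero => exact hres 0
  | succ k ih => rw [cgDir_succ]; exact add_mem (hres _) (Submodule.smul_mem _ _ ih)

theorem cgSpan_mono : Monotone (cgSpan A b y₀) := fun _ _ h =>
  Submodule.span_mono (Set.image_mono (Set.Iio_subset_Iio h))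

theorem cgDir_mem_cgSpan {j k : ℕ} (h : j < k) : cgDir A b y₀ j ∈ cgSpan A b y₀ k :=
  Submodule.subset_span ⟨j, h, rfl⟩

theorem cgSpan_le_range (hb : b ∈ LinearMap.range A.mulVecLin) (k : ℕ) :
    cgSpan A b y₀ k ≤ LinearMap.range A.mulVecLin := by
  rw [cgSpan, Submodule.span_le]
  rintro _ ⟨j, -, rfl⟩
  exact cgDir_mem_range hb j

theorem dotProduct_eq_zero_of_mem_cgSpan {k : ℕ} {v w : ι → ℝ}
    (hv : ∀ j < k, v ⬝ᵥ cgDir A b y₀ j = 0) (hw : w ∈ cgSpan A b y₀ k) : v ⬝ᵥ w = 0 := by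
  suffices cgSpan A b y₀ k ≤ LinearMap.ker (dotProductBilin ℝ ℝ v) from this hw
  rw [cgSpan, Submodule.span_le]
  rintro _ ⟨j, hj, rfl⟩
  exact hv j hj

theorem cgRes_mem_cgSpan (k : ℕ) : cgRes A b y₀ k ∈ cgSpan A b y₀ (k + 1) := by
  cases k with
  | zero => exact cgDir_mem_cgSpan Nat.zero_lt_one
  | succ k =>
    rw [← sub_eq_of_eq_add (cgDir_succ k)]
    exact sub_mem (cgDir_mem_cgSpan (by omega))
      (Submodule.smul_mem _ _ (cgDir_mem_cgSpan (by omega)))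

theorem cgIter_sub_mem_cgSpan (k : ℕ) : cgIter A b y₀ k - y₀ ∈ cgSpan A b y₀ k := by
  induction k with
  | zero => simp [cgIter, cgState]
  | succ k ih =>
    rw [cgIter_succ, add_sub_right_comm]
    exact add_mem (cgSpan_mono k.le_succ ih)
      (Submodule.smul_mem _ _ (cgDir_mem_cgSpan k.lt_succ_self))

theorem mulVec_cgDir (hA : A.PosSemidef) (k : ℕ) :
    A *ᵥ cgDir A b y₀ k =
      (cgStepLength A b y₀ k)⁻¹ • (cgRes A b y₀ k - cgRes A b y₀ (k + 1)) := by
  rw [cgRes_succ, sub_sub_cancel]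
  rcases eq_or_ne (cgStepLength A b y₀ k) 0 with h | h
  · rw [h, zero_smul, smul_zero]
    rcases div_eq_zero_iff.1 h with hr | hp
    · rw [cgDir_eq_zero_of_cgRes_eq_zero (dotProduct_self_eq_zero.1 hr), mulVec_zero]
    · exact (hA.dotProduct_mulVec_zero_iff _).1 hp
  · rw [inv_smul_smul₀ h]

theorem mulVec_mem_cgSpan_succ (hA : A.PosSemidef) {k : ℕ} {w : ι → ℝ}
    (hw : w ∈ cgSpan A b y₀ k) : A *ᵥ w ∈ cgSpan A b y₀ (k + 1) := by
  suffices cgSpan A b y₀ k ≤ (cgSpan A b y₀ (k + 1)).comap A.mulVecLin from this hw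
  rw [cgSpan, Submodule.span_le]
  rintro _ ⟨j, hj : j < k, rfl⟩
  rw [SetLike.mem_coe, Submodule.mem_comap, mulVecLin_apply, mulVec_cgDir hA]
  exact Submodule.smul_mem _ _ (sub_mem (cgSpan_mono (by omega) (cgRes_mem_cgSpan j))
    (cgSpan_mono (by omega) (cgRes_mem_cgSpan (j + 1))))

theorem pow_mulVec_cgRes_zero_mem_cgSpan [DecidableEq ι] (hA : A.PosSemidef) (k : ℕ) :
    (A ^ k) *ᵥ cgRes A b y₀ 0 ∈ cgSpan A b y₀ (k + 1) := by
  induction k with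
  | zero => rw [pow_zero, one_mulVec]; exact cgRes_mem_cgSpan 0
  | succ k ih => rw [pow_succ', ← mulVec_mulVec]; exact mulVec_mem_cgSpan_succ hA ih

theorem aeval_mulVec_sub_mem_cgSpan [DecidableEq ι] (hA : A.PosSemidef) {y : ι → ℝ}
    (hy : A *ᵥ y = b) {k : ℕ} {q : ℝ[X]} (hq : q.natDegree ≤ k) (hq0 : q.eval 0 = 1) :
    aeval A q *ᵥ (y₀ - y) - (y₀ - y) ∈ cgSpan A b y₀ k := by
  have hres : A *ᵥ (y₀ - y) = -cgRes A b y₀ 0 := by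
    rw [mulVec_sub, hy, cgRes_eq_sub_mulVec, neg_sub, cgIter, cgState]
  have hexpand : aeval A q *ᵥ (y₀ - y) - (y₀ - y) =
      ∑ j ∈ Finset.range k, q.coeff (j + 1) • -((A ^ j) *ᵥ cgRes A b y₀ 0) := by
    rw [aeval_eq_sum_range' (Nat.lt_succ_of_le hq), Finset.sum_range_succ', coeff_zero_eq_eval_zero,
      hq0, pow_zero, one_smul, add_mulVec, one_mulVec, add_sub_cancel_right, sum_mulVec]
    exact Finset.sum_congr rfl fun j _ => by
      rw [smul_mulVec, pow_succ, ← mulVec_mulVec, hres, mulVec_neg]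
  rw [hexpand]
  exact Submodule.sum_mem _ fun j hj => Submodule.smul_mem _ _ <| neg_mem <|
    cgSpan_mono (Finset.mem_range.1 hj) (pow_mulVec_cgRes_zero_mem_cgSpan hA j)

theorem cgDir_dotProduct_cgRes_of_forall {k : ℕ}
    (h : ∀ j < k, cgRes A b y₀ k ⬝ᵥ cgDir A b y₀ j = 0) :
    cgDir A b y₀ k ⬝ᵥ cgRes A b y₀ k = cgRes A b y₀ k ⬝ᵥ cgRes A b y₀ k := by
  cases k with
  | zero => rfl
  | succ k =>
    rw [cgDir_succ, add_dotProduct, smul_dotProduct, dotProduct_comm (cgDir A b y₀ k),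
      h k k.lt_succ_self, smul_zero, add_zero]

theorem cgStepLength_mul_of_forall (hA : A.PosSemidef) (hb : b ∈ LinearMap.range A.mulVecLin)
    {k : ℕ} (h : ∀ j < k, cgRes A b y₀ k ⬝ᵥ cgDir A b y₀ j = 0) :
    cgStepLength A b y₀ k * (cgDir A b y₀ k ⬝ᵥ (A *ᵥ cgDir A b y₀ k)) =
      cgRes A b y₀ k ⬝ᵥ cgRes A b y₀ k := by
  rcases eq_or_ne (cgDir A b y₀ k) 0 with hp | hp
  · rw [← cgDir_dotProduct_cgRes_of_forall h, hp]
    simp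
  · exact div_mul_cancel₀ _ (dotProduct_mulVec_pos_of_mem_range hA (cgDir_mem_range hb k) hp).ne'

theorem cgRes_succ_orthogonal (hA : A.PosSemidef) (hb : b ∈ LinearMap.range A.mulVecLin) {k : ℕ}
    (horth : ∀ j < k, cgRes A b y₀ k ⬝ᵥ cgDir A b y₀ j = 0)
    (hconj : ∀ j < k, cgDir A b y₀ k ⬝ᵥ (A *ᵥ cgDir A b y₀ j) = 0) :
    ∀ j < k + 1, cgRes A b y₀ (k + 1) ⬝ᵥ cgDir A b y₀ j = 0 := by
  intro j hj
  rw [cgRes_succ, sub_dotProduct, smul_dotProduct,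
    mulVec_dotProduct_comm (isHermitian_iff_isSymm.1 hA.isHermitian)]
  rcases Nat.lt_succ_iff_lt_or_eq.1 hj with hjk | rfl
  · rw [horth j hjk, hconj j hjk, smul_zero, sub_zero]
  · rw [smul_eq_mul, cgStepLength_mul_of_forall hA hb horth, dotProduct_comm,
      cgDir_dotProduct_cgRes_of_forall horth, sub_self]

theorem cgDir_succ_conjugate (hA : A.PosSemidef) {k : ℕ}
    (horth : ∀ j < k + 1, cgRes A b y₀ (k + 1) ⬝ᵥ cgDir A b y₀ j = 0)
    (hconj : ∀ j < k, cgDir A b y₀ k ⬝ᵥ (A *ᵥ cgDir A b y₀ j) = 0) :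
    ∀ j < k + 1, cgDir A b y₀ (k + 1) ⬝ᵥ (A *ᵥ cgDir A b y₀ j) = 0 := by
  have hres : ∀ j < k + 1, cgRes A b y₀ (k + 1) ⬝ᵥ cgRes A b y₀ j = 0 := fun j hj =>
    dotProduct_eq_zero_of_mem_cgSpan horth (cgSpan_mono hj (cgRes_mem_cgSpan j))
  intro j hj
  have hexpand : cgDir A b y₀ (k + 1) ⬝ᵥ (A *ᵥ cgDir A b y₀ j) =
      -(cgStepLength A b y₀ j)⁻¹ * (cgRes A b y₀ (k + 1) ⬝ᵥ cgRes A b y₀ (j + 1)) +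
        cgDirWeight A b y₀ k * (cgDir A b y₀ k ⬝ᵥ (A *ᵥ cgDir A b y₀ j)) := by
    rw [cgDir_succ, add_dotProduct, smul_dotProduct, smul_eq_mul, add_left_inj, mulVec_cgDir hA,
      dotProduct_smul, dotProduct_sub, hres j hj, smul_eq_mul]
    ring
  rw [hexpand]
  rcases Nat.lt_succ_iff_lt_or_eq.1 hj with hjk | rfl
  · rw [hres (j + 1) (by omega), hconj j hjk, mul_zero, mul_zero, add_zero]
  · rw [cgStepLength, cgDirWeight, inv_div]
    ring

theorem cg_orthogonal_and_conjugate (hA : A.PosSemidef) (hb : b ∈ LinearMap.range A.mulVecLin)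
    (k : ℕ) :
    (∀ j < k, cgRes A b y₀ k ⬝ᵥ cgDir A b y₀ j = 0) ∧
      ∀ j < k, cgDir A b y₀ k ⬝ᵥ (A *ᵥ cgDir A b y₀ j) = 0 := by
  induction k with
  | zero => simp
  | succ k ih =>
    have horth := cgRes_succ_orthogonal hA hb ih.1 ih.2
    exact ⟨horth, cgDir_succ_conjugate hA horth ih.2⟩

theorem cgDir_dotProduct_mulVec_pos (hA : A.PosSemidef) (hb : b ∈ LinearMap.range A.mulVecLin)
    {k : ℕ} (hk : cgRes A b y₀ k ≠ 0) : 0 < cgDir A b y₀ k ⬝ᵥ (A *ᵥ cgDir A b y₀ k) := by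
  refine dotProduct_mulVec_pos_of_mem_range hA (cgDir_mem_range hb k) fun hp => hk ?_
  rw [← dotProduct_self_eq_zero,
    ← cgDir_dotProduct_cgRes_of_forall (cg_orthogonal_and_conjugate hA hb k).1, hp, zero_dotProduct]

theorem energyNorm_le_energyNorm_add (hA : A.PosSemidef) {e d : ι → ℝ}
    (h : d ⬝ᵥ (A *ᵥ e) = 0) : energyNorm A e ≤ energyNorm A (e + d) := by
  have hsymm : e ⬝ᵥ (A *ᵥ d) = 0 := by
    rw [← mulVec_dotProduct_comm (isHermitian_iff_isSymm.1 hA.isHermitian), dotProduct_comm, h]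
  have hd : 0 ≤ d ⬝ᵥ (A *ᵥ d) := hA.dotProduct_mulVec_nonneg d
  refine Real.sqrt_le_sqrt ?_
  rw [mulVec_add, add_dotProduct, dotProduct_add, dotProduct_add, h, hsymm]
  linarith

theorem energyNorm_cgIter_sub_le_of_sub_mem_cgSpan (hA : A.PosSemidef) {y : ι → ℝ}
    (hy : A *ᵥ y = b) {k : ℕ} {x : ι → ℝ} (hx : x - y₀ ∈ cgSpan A b y₀ k) :
    energyNorm A (cgIter A b y₀ k - y) ≤ energyNorm A (x - y) := by
  have hres : A *ᵥ (cgIter A b y₀ k - y) = -cgRes A b y₀ k := by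
    rw [mulVec_sub, hy, cgRes_eq_sub_mulVec, neg_sub]
  have hmem : x - cgIter A b y₀ k ∈ cgSpan A b y₀ k := by
    simpa using sub_mem hx (cgIter_sub_mem_cgSpan k)
  have horth : (x - cgIter A b y₀ k) ⬝ᵥ (A *ᵥ (cgIter A b y₀ k - y)) = 0 := by
    rw [hres, dotProduct_neg, dotProduct_comm, dotProduct_eq_zero_of_mem_cgSpan
      (cg_orthogonal_and_conjugate hA ⟨y, hy⟩ k).1 hmem, neg_zero]
  simpa using energyNorm_le_energyNorm_add hA horth

end ConjugateGradient

/-! ### Convergence -/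

section Convergence

variable {ι : Type*} [Fintype ι] [DecidableEq ι] {A : Matrix ι ι ℝ} {b y₀ y : ι → ℝ} {a c : ℝ}

theorem energyNorm_cgIter_sub_le (hA : A.PosSemidef) (hc : 0 < c) (hca : c ≤ a)
    (hspec : nonzeroEigenvalues A ⊆ Set.Icc c a) (hy : A *ᵥ y = b) (k : ℕ) :
    energyNorm A (cgIter A b y₀ k - y) ≤ 2 * cgRate a c ^ k * energyNorm A (y₀ - y) := by
  have hρ := cgRate_nonneg hc hca
  obtain ⟨q, hdeg, hq0, hq⟩ := exists_natDegree_le_eval_zero_eq_one_abs_eval_le hc hca k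
  have hmem : y + aeval A q *ᵥ (y₀ - y) - y₀ ∈ cgSpan A b y₀ k := by
    convert aeval_mulVec_sub_mem_cgSpan hA hy hdeg hq0 using 1
    abel
  calc energyNorm A (cgIter A b y₀ k - y)
      ≤ energyNorm A (y + aeval A q *ᵥ (y₀ - y) - y) :=
        energyNorm_cgIter_sub_le_of_sub_mem_cgSpan hA hy hmem
    _ = energyNorm A (aeval A q *ᵥ (y₀ - y)) := by rw [add_sub_cancel_left]
    _ ≤ 2 * cgRate a c ^ k * energyNorm A (y₀ - y) :=
        energyNorm_aeval_mulVec_le hA (by positivity) (fun x hx => hq x (hspec hx)) _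

theorem euclNorm_cgIter_sub_le (hA : A.PosSemidef) (hc : 0 < c) (hca : c ≤ a)
    (hspec : nonzeroEigenvalues A ⊆ Set.Icc c a) (hy : A *ᵥ y = b)
    (hy₀ : y₀ - y ∈ LinearMap.range A.mulVecLin) (k : ℕ) :
    euclNorm (cgIter A b y₀ k - y) ≤
      2 * √(a / c) * cgRate a c ^ k * euclNorm (y₀ - y) := by
  have hρ := cgRate_nonneg hc hca
  have hsqrt : 0 < √c := Real.sqrt_pos.2 hc
  have hrange : cgIter A b y₀ k - y ∈ LinearMap.range A.mulVecLin := by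
    rw [← sub_add_sub_cancel _ y₀]
    exact add_mem (cgSpan_le_range ⟨y, hy⟩ k (cgIter_sub_mem_cgSpan k)) hy₀
  refine le_of_mul_le_mul_left ?_ hsqrt
  calc √c * euclNorm (cgIter A b y₀ k - y)
      ≤ energyNorm A (cgIter A b y₀ k - y) :=
        sqrt_mul_euclNorm_le_energyNorm hA.isHermitian hc.le (fun x hx => (hspec hx).1) hrange
    _ ≤ 2 * cgRate a c ^ k * energyNorm A (y₀ - y) :=
        energyNorm_cgIter_sub_le hA hc hca hspec hy k
    _ ≤ 2 * cgRate a c ^ k * (√a * euclNorm (y₀ - y)) := by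
        gcongr
        exact energyNorm_le_sqrt_mul_euclNorm hA.isHermitian (hc.le.trans hca)
          (fun x hx => (hspec hx).2) _
    _ = √c * (2 * √(a / c) * cgRate a c ^ k * euclNorm (y₀ - y)) := by
        rw [Real.sqrt_div (hc.le.trans hca)]
        field_simp

theorem tendsto_cgIter (hA : A.PosSemidef) (hc : 0 < c) (hca : c ≤ a)
    (hspec : nonzeroEigenvalues A ⊆ Set.Icc c a) (hy : A *ᵥ y = b)
    (hy₀ : y₀ - y ∈ LinearMap.range A.mulVecLin) : Tendsto (cgIter A b y₀) atTop (𝓝 y) :=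
  tendsto_of_euclNorm_sub_le_geometric (C := 2 * √(a / c) * euclNorm (y₀ - y))
    (cgRate_nonneg hc hca) (cgRate_lt_one a c) fun k =>
      (euclNorm_cgIter_sub_le hA hc hca hspec hy hy₀ k).trans_eq (by ring)

theorem theorem2_general (hA : A.PosSemidef) (hA0 : A ≠ 0)
    (hb : b ∈ LinearMap.range A.mulVecLin) :
    ∃ lam₁ lamᵣ : ℝ,
      IsGreatest (nonzeroEigenvalues A) lam₁ ∧ IsLeast (nonzeroEigenvalues A) lamᵣ ∧
      0 < lamᵣ ∧
      0 ≤ cgRate lam₁ lamᵣ ∧ cgRate lam₁ lamᵣ < 1 ∧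
      ∀ y₀ : ι → ℝ,
        (∀ k : ℕ, (cgState A b y₀ k).res ≠ 0 →
          0 < (cgState A b y₀ k).dir ⬝ᵥ (A *ᵥ (cgState A b y₀ k).dir)) ∧
        (∀ y : ι → ℝ, A *ᵥ y = b → ∀ k : ℕ,
          energyNorm A (cgIter A b y₀ k - y) ≤
            2 * cgRate lam₁ lamᵣ ^ k * energyNorm A (y₀ - y)) ∧
        (∃ y : ι → ℝ, A *ᵥ y = b ∧
          Tendsto (cgIter A b y₀) atTop (𝓝 y) ∧
          ∀ k : ℕ, euclNorm (cgIter A b y₀ k - y) ≤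
            2 * √(lam₁ / lamᵣ) * cgRate lam₁ lamᵣ ^ k * euclNorm (y₀ - y)) := by
  have hcompact := (finite_nonzeroEigenvalues hA.isHermitian).isCompact
  have hne := nonempty_nonzeroEigenvalues hA.isHermitian hA0
  obtain ⟨lam₁, h₁⟩ := hcompact.exists_isGreatest hne
  obtain ⟨lamᵣ, hᵣ⟩ := hcompact.exists_isLeast hne
  have hpos : 0 < lamᵣ := pos_of_mem_nonzeroEigenvalues hA hᵣ.1
  have hle : lamᵣ ≤ lam₁ := hᵣ.2 h₁.1
  have hspec : nonzeroEigenvalues A ⊆ Set.Icc lamᵣ lam₁ := fun x hx => ⟨hᵣ.2 hx, h₁.2 hx⟩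
  refine ⟨lam₁, lamᵣ, h₁, hᵣ, hpos, cgRate_nonneg hpos hle, cgRate_lt_one _ _, fun y₀ =>
    ⟨fun _ => cgDir_dotProduct_mulVec_pos hA hb,
      fun _ => energyNorm_cgIter_sub_le hA hpos hle hspec, ?_⟩⟩
  obtain ⟨y, hy, hy₀⟩ :=
    exists_mulVec_eq_sub_mem_range (isHermitian_iff_isSymm.1 hA.isHermitian) hb y₀
  exact ⟨y, hy, tendsto_cgIter hA hpos hle hspec hy hy₀,
    euclNorm_cgIter_sub_le hA hpos hle hspec hy hy₀⟩

end Convergence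

/-! ### The adjoint system -/

section Adjoint

variable {n m : ℕ} {μ : Fin n → ℝ} {ν : Fin m → ℝ} {T : Matrix (Fin n) (Fin m) ℝ}

/-- The matrix `(vᵢ + vⱼ)ᵢⱼ` of the sums of the entries of the two blocks of `v`: the transpose of
the map that sends a matrix to its row and column sums. -/
def blockSum (v : Fin n ⊕ Fin m → ℝ) : Matrix (Fin n) (Fin m) ℝ :=
  Matrix.of fun i j => v (Sum.inl i) + v (Sum.inr j)

theorem dotProduct_adjointRhs (T G : Matrix (Fin n) (Fin m) ℝ) (v : Fin n ⊕ Fin m → ℝ) :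
    v ⬝ᵥ adjointRhs T G = ∑ i, ∑ j, T i j * G i j * blockSum v i j := by
  have hcol : ∑ j, ∑ i, v (Sum.inr j) * (T i j * G i j) =
      ∑ i, ∑ j, v (Sum.inr j) * (T i j * G i j) := Finset.sum_comm
  simp only [adjointRhs, dotProduct, Fintype.sum_sum_type, Sum.elim_inl, Sum.elim_inr,
    mulVec, hadamard_apply, transpose_apply, Pi.one_apply, mul_one, Finset.mul_sum]
  simp only [hcol, ← Finset.sum_add_distrib, blockSum, of_apply]
  exact Finset.sum_congr rfl fun i _ => Finset.sum_congr rfl fun j _ => by ring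

theorem isSymm_adjointMatrix (μ : Fin n → ℝ) (ν : Fin m → ℝ) (T : Matrix (Fin n) (Fin m) ℝ) :
    (adjointMatrix μ ν T).IsSymm :=
  (isSymm_diagonal μ).fromBlocks rfl (isSymm_diagonal ν)

theorem adjointMatrix_ne_zero (hμ : μ ≠ 0) : adjointMatrix μ ν T ≠ 0 := fun h =>
  hμ (diagonal_eq_zero.1 (congrArg Matrix.toBlocks₁₁ h))

theorem ne_zero_of_mem_stdSimplex {ι R : Type*} [Fintype ι] [Semiring R] [PartialOrder R]
    [Nontrivial R] {w : ι → R} (hw : w ∈ stdSimplex R ι) : w ≠ 0 := by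
  rintro rfl
  simpa using hw.2

namespace IsTransportPlan

theorem adjointMatrix_mulVec (hT : IsTransportPlan μ ν T) (v : Fin n ⊕ Fin m → ℝ) :
    adjointMatrix μ ν T *ᵥ v = adjointRhs T (blockSum v) := by
  have hμ : ∀ i, μ i = ∑ j, T i j := fun i => by simp [← hT.row_sum, mulVec, dotProduct]
  have hν : ∀ j, ν j = ∑ i, T i j := fun j => by simp [← hT.col_sum, mulVec, dotProduct]
  rw [adjointMatrix, fromBlocks_mulVec, adjointRhs]
  congr 1
  · ext i
    rw [Pi.add_apply, mulVec_diagonal, hμ]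
    simp [mulVec, dotProduct, blockSum, mul_add, Finset.sum_add_distrib, Finset.sum_mul]
  · ext j
    rw [Pi.add_apply, mulVec_diagonal, hν]
    simp [mulVec, dotProduct, blockSum, mul_add, Finset.sum_add_distrib, Finset.sum_mul]

theorem dotProduct_adjointMatrix_mulVec (hT : IsTransportPlan μ ν T)
    (v : Fin n ⊕ Fin m → ℝ) :
    v ⬝ᵥ (adjointMatrix μ ν T *ᵥ v) = ∑ i, ∑ j, T i j * blockSum v i j ^ 2 := by
  simp only [hT.adjointMatrix_mulVec, dotProduct_adjointRhs, sq, mul_assoc]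

theorem mul_blockSum_sq_nonneg (hT : IsTransportPlan μ ν T) (v : Fin n ⊕ Fin m → ℝ) (i : Fin n)
    (j : Fin m) : 0 ≤ T i j * blockSum v i j ^ 2 :=
  mul_nonneg (hT.nonneg i j) (sq_nonneg _)

theorem posSemidef_adjointMatrix (hT : IsTransportPlan μ ν T) :
    (adjointMatrix μ ν T).PosSemidef := by
  have hH := isHermitian_iff_isSymm.2 (isSymm_adjointMatrix μ ν T)
  refine .of_dotProduct_mulVec_nonneg hH fun v => ?_
  rw [star_trivial, hT.dotProduct_adjointMatrix_mulVec]
  exact Finset.sum_nonneg fun i _ => Finset.sum_nonneg fun j _ => hT.mul_blockSum_sq_nonneg v i j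

theorem mul_blockSum_eq_zero (hT : IsTransportPlan μ ν T) {v : Fin n ⊕ Fin m → ℝ}
    (hv : adjointMatrix μ ν T *ᵥ v = 0) (i : Fin n) (j : Fin m) : T i j * blockSum v i j = 0 := by
  have hsum : ∑ i, ∑ j, T i j * blockSum v i j ^ 2 = 0 := by
    rw [← hT.dotProduct_adjointMatrix_mulVec, hv, dotProduct_zero]
  have hrow := (Fintype.sum_eq_zero_iff_of_nonneg fun i =>
    Finset.sum_nonneg fun j _ => hT.mul_blockSum_sq_nonneg v i j).1 hsum
  have hentry := (Fintype.sum_eq_zero_iff_of_nonneg (hT.mul_blockSum_sq_nonneg v i)).1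
    (congrFun hrow i)
  simpa using congrFun hentry j

theorem adjointRhs_mem_range (hT : IsTransportPlan μ ν T) (G : Matrix (Fin n) (Fin m) ℝ) :
    adjointRhs T G ∈ LinearMap.range (adjointMatrix μ ν T).mulVecLin := by
  refine mem_range_mulVecLin_of_forall_dotProduct_eq_zero (isSymm_adjointMatrix μ ν T)
    fun v hv => ?_
  rw [dotProduct_adjointRhs]
  exact Finset.sum_eq_zero fun i _ => Finset.sum_eq_zero fun j _ => by
    rw [mul_right_comm, hT.mul_blockSum_eq_zero hv, zero_mul]

end IsTransportPlan

end Adjoint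

theorem theorem2 {n m : ℕ}
    (μ : Fin n → ℝ) (hμ : μ ∈ stdSimplex ℝ (Fin n))
    (ν : Fin m → ℝ) (hν : ν ∈ stdSimplex ℝ (Fin m))
    (T : Matrix (Fin n) (Fin m) ℝ) (hT : IsTransportPlan μ ν T)
    (f : Matrix (Fin n) (Fin m) ℝ → ℝ) (G : Matrix (Fin n) (Fin m) ℝ)
    (hG : HasMatrixGradientAt f G T)
    (A : Matrix (Fin n ⊕ Fin m) (Fin n ⊕ Fin m) ℝ) (hA : A = adjointMatrix μ ν T)
    (b : Fin n ⊕ Fin m → ℝ) (hb : b = adjointRhs T G) :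
    ∃ lam₁ lamᵣ : ℝ,
      IsGreatest (nonzeroEigenvalues A) lam₁ ∧ IsLeast (nonzeroEigenvalues A) lamᵣ ∧
      0 < lamᵣ ∧
      0 ≤ cgRate lam₁ lamᵣ ∧ cgRate lam₁ lamᵣ < 1 ∧
      ∀ y₀ : Fin n ⊕ Fin m → ℝ,
        -- the method is well defined: no breakdown before the residual vanishes
        (∀ k : ℕ, (cgState A b y₀ k).res ≠ 0 →
          0 < (cgState A b y₀ k).dir ⬝ᵥ (A *ᵥ (cgState A b y₀ k).dir)) ∧
        -- the error bound in the energy norm, relative to every solution of the system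
        (∀ y : Fin n ⊕ Fin m → ℝ, A *ᵥ y = b → ∀ k : ℕ,
          energyNorm A (cgIter A b y₀ k - y) ≤
            2 * cgRate lam₁ lamᵣ ^ k * energyNorm A (y₀ - y)) ∧
        -- convergence of the iterates to a solution, at the linear rate
        (∃ y : Fin n ⊕ Fin m → ℝ, A *ᵥ y = b ∧
          Filter.Tendsto (cgIter A b y₀) Filter.atTop (nhds y) ∧
          ∀ k : ℕ, euclNorm (cgIter A b y₀ k - y) ≤
            2 * √(lam₁ / lamᵣ) * cgRate lam₁ lamᵣ ^ k * euclNorm (y₀ - y)) := by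
  subst hA hb
  exact theorem2_general hT.posSemidef_adjointMatrix
    (adjointMatrix_ne_zero (ne_zero_of_mem_stdSimplex hμ)) (hT.adjointRhs_mem_range G)
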